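/- **Conventions.** A *hyperbolic manifold* is a quotient $N=\mathbb H^3/\Gamma$, where $\Gamma$ is a discrete torsion-free group of isometries of $\mathbb H^3$; let $\pi\colon\mathbb H^3\to N$ be the covering map, $d$ the distance of $N$, and $B_R(x)$ the open metric ball. A submanifold (more generally, a subset) $Q\subset N$ is *convex* if $\pi^{-1}(Q)$ is a convex subset of $\mathbb H^3$. Write $Q^{\ge\epsilon}$ (resp. $Q^{>\epsilon}$) for the set of points of $Q$ at which the injectivity radius of $Q$ is at least (resp. greater than) $\epsilon/2$; the case $Q=N$ is included. Here the injectivity radius of $Q$ at $\pi(\tilde p)\in Q$ is the supremum in $[0,\infty]$ of the $r$ such that $\pi$ is injective on $\pi^{-1}(Q)\cap B_r(\tilde p)$. For $J>1$, a *$J$-bilipschitz inclusion* $h\colon A\hookrightarrow B$ between subsets of hyperbolic manifolds is a map with $J^{-1}d(x,x')\le d(h(x),h(x'))\le J\,d(x,x')$ for all $x,x'\in A$. For subsets $Q_m\subset N_m$ of hyperbolic manifolds and points $x_m\in Q_m$, $x\in N$, we say that $(Q_m,x_m)\to(N,x)$ *converges geometrically* if for every $R>0$ there are, for all large $m$, smooth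 embeddings $g_m\colon B_R(x)\to N_m$ with $g_m(B_R(x))\subset Q_m$ and $g_m(x)=x_m$, which converge to isometries in the $C^\infty$ topology as $m\to\infty$ (that is, on the $R$-ball about a lift of $x$ the maps $g_m$ lift to $A_m\circ F_m$, where the $A_m$ are isometries of $\mathbb H^3$ and all derivatives of $F_m$ converge uniformly on compact sets to those of the identity). **Theorem 5.1 (Bilipschitz limit).** Fix $\delta>0$, $\epsilon>0$ and $J>1$. Let $(Y_m,y_m)\to(Y,y)$ and $(Z_m,z_m)\to(Z,z)$ be geometrically converging sequences of based hyperbolic manifolds. For each $m$, let $Y_m^\circ$ and $Z_m^\circ$ be convex submanifolds of $Y_m$ and $Z_m$, respectively. Suppose that $y\in Y^{>\epsilon}$, that $y_m\in(Y_m^\circ)^{\ge\epsilon}$ and $z_m\in Z_m^\circ$ for all $m$, and that $(Y_m^\circ,y_m)\to(Y,y)$ and $(Z_m^\circ,z_m)\to(Z,z)$ converge geometrically. Suppose also that $Y^{\ge\epsilon}$ is the closure of $Y^{>\epsilon}$. Suppose that for each $m$ there is a $J$-bilipschitz inclusion $\varphi_m\colon(Y_m^\circ)^{\ge\epsilon}\hookrightarrow(Z_m^\circ)^{\ge\delta}$,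 such that $d(\varphi_m(y_m),z_m)$ is bounded uniformly in $m$. Then there is a $J$-bilipschitz inclusion $\varphi\colon Y^{\ge\epsilon}\hookrightarrow Z^{\ge\delta}$. -/

import Mathlib

open Set Filter Topology
open scoped NNReal ENNReal ContDiff

/-! ### Hyperbolic 3-space -/

/-- Hyperbolic 3-space in the upper half-space model: points of `ℝ³` whose last coordinate is
positive. -/
@[ext]
structure HypSpace where
  /-- The point of `ℝ³`. -/
  coord : EuclideanSpace ℝ (Fin 3)
  pos : 0 < coord 2

namespace HypSpace

/-- The mirror image of a point in the boundary plane. -/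
noncomputable def mirror (p : HypSpace) : EuclideanSpace ℝ (Fin 3) :=
  !₂[p.coord 0, p.coord 1, -p.coord 2]

/-- The hyperbolic distance: `2 arsinh (|p - q| / (2 √(p₂ q₂)))`, equivalently
`cosh d(p, q) = 1 + |p - q|² / (2 p₂ q₂)`. -/
noncomputable instance : Dist HypSpace :=
  ⟨fun p q => 2 * Real.arsinh (dist p.coord q.coord / (2 * √(p.coord 2 * q.coord 2)))⟩

theorem dist_def (p q : HypSpace) :
    dist p q = 2 * Real.arsinh (dist p.coord q.coord / (2 * √(p.coord 2 * q.coord 2))) :=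
  rfl

theorem euclid_dist_sq (v w : EuclideanSpace ℝ (Fin 3)) :
    dist v w ^ 2 = (v 0 - w 0) ^ 2 + (v 1 - w 1) ^ 2 + (v 2 - w 2) ^ 2 := by
  rw [EuclideanSpace.dist_eq, Real.sq_sqrt (by positivity), Fin.sum_univ_three]
  simp only [Real.dist_eq, sq_abs]

theorem sinh_half_dist (p q : HypSpace) :
    Real.sinh (dist p q / 2) = dist p.coord q.coord / (2 * √(p.coord 2 * q.coord 2)) := by
  rw [dist_def, mul_div_cancel_left₀ (Real.arsinh _) two_ne_zero, Real.sinh_arsinh]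

theorem cosh_half_dist (p q : HypSpace) :
    Real.cosh (dist p q / 2) = dist p.coord q.mirror / (2 * √(p.coord 2 * q.coord 2)) := by
  have hp := p.pos
  have hq := q.pos
  have hs : 0 < √(p.coord 2 * q.coord 2) := by positivity
  rw [← sq_eq_sq₀ (Real.cosh_pos _).le (by positivity), Real.cosh_sq', sinh_half_dist, div_pow,
    div_pow, mul_pow, Real.sq_sqrt (by positivity), euclid_dist_sq, euclid_dist_sq]
  simp only [mirror, PiLp.toLp_apply, Matrix.cons_val]
  field_simp
  ring

theorem dist_mirror_comm (p q : HypSpace) :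
    dist p.coord q.mirror = dist q.coord p.mirror := by
  rw [← sq_eq_sq₀ dist_nonneg dist_nonneg, euclid_dist_sq, euclid_dist_sq]
  simp only [mirror, PiLp.toLp_apply, Matrix.cons_val]
  ring

theorem dist_self_mirror (p : HypSpace) : dist p.coord p.mirror = 2 * p.coord 2 := by
  have hp := p.pos
  rw [← sq_eq_sq₀ dist_nonneg (by positivity), euclid_dist_sq]
  simp only [mirror, PiLp.toLp_apply, Matrix.cons_val]
  ring

theorem sinh_half_dist_add_dist (a b c : HypSpace) :
    Real.sinh ((dist a b + dist b c) / 2) =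
      (dist a.coord b.coord * dist c.coord b.mirror + dist b.coord c.coord * dist a.coord b.mirror)
        / (2 * √(a.coord 2 * c.coord 2) * (2 * b.coord 2)) := by
  have ha := a.pos
  have hb := b.pos
  have hc := c.pos
  rw [add_div, Real.sinh_add, sinh_half_dist, cosh_half_dist, sinh_half_dist, cosh_half_dist,
    dist_mirror_comm b c, Real.sqrt_mul ha.le, Real.sqrt_mul hb.le, Real.sqrt_mul ha.le]
  have h1 : 0 < √(a.coord 2) := Real.sqrt_pos.2 ha
  have h2 : 0 < √(b.coord 2) := Real.sqrt_pos.2 hb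
  have h3 : 0 < √(c.coord 2) := Real.sqrt_pos.2 hc
  have h4 : b.coord 2 = √(b.coord 2) ^ 2 := (Real.sq_sqrt hb.le).symm
  generalize √(b.coord 2) = s at *
  rw [h4]
  field_simp

noncomputable instance : MetricSpace HypSpace where
  dist_self p := by simp [dist_def]
  dist_comm p q := by simp only [dist_def, dist_comm p.coord, mul_comm (p.coord 2)]
  dist_triangle a b c := by
    have ha := a.pos
    have hb := b.pos
    have hc := c.pos
    have key : Real.sinh (dist a c / 2) ≤ Real.sinh ((dist a b + dist b c) / 2) := by
      rw [sinh_half_dist, sinh_half_dist_add_dist, ← dist_self_mirror b,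
        div_mul_eq_div_div _ _ (dist _ _), le_div_iff₀ (by rw [dist_self_mirror]; positivity),
        div_mul_eq_mul_div]
      gcongr
      exact EuclideanGeometry.mul_dist_le_mul_dist_add_mul_dist a.coord b.coord c.coord b.mirror
    have := Real.sinh_le_sinh.1 key
    linarith
  eq_of_dist_eq_zero {p q} h := by
    have hp := p.pos
    have hq := q.pos
    have h' := sinh_half_dist p q
    rw [h, zero_div, Real.sinh_zero, eq_comm, div_eq_zero_iff] at h'
    rcases h' with h' | h'
    · exact HypSpace.ext (dist_eq_zero.1 h')
    · exact absurd h' (by positivity)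

/-- A set is (geodesically) convex if it contains the geodesic segment between any two of its
points; the segment from `p` to `q` is the set of all `u` with `d(p, u) + d(u, q) = d(p, q)`. -/
def IsConvex (S : Set HypSpace) : Prop :=
  ∀ p ∈ S, ∀ q ∈ S, ∀ u, dist p u + dist u q = dist p q → u ∈ S

open Classical in
/-- A self-map of hyperbolic space as a map between subsets of `ℝ³` (extended by the identity
outside the upper half-space). -/
noncomputable def inCoords (F : HypSpace → HypSpace) (v : EuclideanSpace ℝ (Fin 3)) :
    EuclideanSpace ℝ (Fin 3) :=
  if h : 0 < v 2 then (F ⟨v, h⟩).coord else v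

/-- `F` is a smooth immersion (that is, a local diffeomorphism) on the open set `B`. -/
def IsSmoothImmersionOn (F : HypSpace → HypSpace) (B : Set HypSpace) : Prop :=
  ContDiffOn ℝ ∞ (inCoords F) (coord '' B) ∧
    ∀ v ∈ coord '' B, Function.Injective (fderiv ℝ (inCoords F) v)

/-- The maps `F m` converge to the identity on the open set `B` in the `C^∞` topology: all
derivatives, of every order, converge uniformly on every compact subset of `B`. -/
def TendstoIdSmoothly (F : ℕ → HypSpace → HypSpace) (B : Set HypSpace) : Prop :=
  ∀ k : ℕ, ∀ K ⊆ coord '' B, IsCompact K →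
    TendstoUniformlyOn (fun m => iteratedFDeriv ℝ k (inCoords (F m)))
      (iteratedFDeriv ℝ k (id : EuclideanSpace ℝ (Fin 3) → EuclideanSpace ℝ (Fin 3))) atTop K

end HypSpace

/-! ### Hyperbolic 3-manifolds -/

/-- A (complete, connected) hyperbolic 3-manifold, presented as the quotient of hyperbolic space by
a group of isometries acting properly discontinuously and freely, that is, by a discrete
torsion-free group. -/
structure HypManifold where
  /-- The group of deck transformations. -/
  group : Subgroup (HypSpace ≃ᵢ HypSpace)
  discrete : ∀ (x : HypSpace) (r : ℝ), {γ | γ ∈ group ∧ dist x (γ x) ≤ r}.Finite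
  free : ∀ γ ∈ group, ∀ x : HypSpace, γ x = x → γ = 1

namespace HypManifold

/-- Two points of hyperbolic space are equivalent if they lie in the same orbit. -/
def orbitSetoid (N : HypManifold) : Setoid HypSpace where
  r x y := ∃ γ ∈ N.group, γ x = y
  iseqv :=
    { refl := fun _ => ⟨1, N.group.one_mem, rfl⟩
      symm := by
        rintro x _ ⟨γ, hγ, rfl⟩
        exact ⟨γ⁻¹, N.group.inv_mem hγ, γ.symm_apply_apply x⟩
      trans := by
        rintro x _ _ ⟨γ, hγ, rfl⟩ ⟨γ', hγ', rfl⟩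
        exact ⟨γ' * γ, N.group.mul_mem hγ' hγ, rfl⟩ }

/-- The points of the manifold: orbits of the group. -/
def Point (N : HypManifold) : Type :=
  Quotient N.orbitSetoid

instance : CoeSort HypManifold Type :=
  ⟨Point⟩

/-- The universal covering map. -/
def proj (N : HypManifold) (x : HypSpace) : N :=
  Quotient.mk N.orbitSetoid x

theorem proj_surjective (N : HypManifold) : Function.Surjective N.proj :=
  Quotient.exists_rep

theorem proj_eq_proj (N : HypManifold) {x y : HypSpace} :
    N.proj x = N.proj y ↔ ∃ γ ∈ N.group, γ x = y :=
  Quotient.eq (r := N.orbitSetoid)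

/-- The distance in the quotient: the infimum of the distances between lifts. -/
noncomputable instance (N : HypManifold) : Dist N :=
  ⟨fun p q => sInf {r | ∃ x y, N.proj x = p ∧ N.proj y = q ∧ dist x y = r}⟩

theorem dist_proj_le (N : HypManifold) (x y : HypSpace) :
    dist (N.proj x) (N.proj y) ≤ dist x y :=
  csInf_le ⟨0, by rintro _ ⟨x, y, -, -, rfl⟩; exact dist_nonneg⟩ ⟨x, y, rfl, rfl, rfl⟩

/-- The distance is realized by lifts, one of which can be prescribed. -/
theorem exists_dist_eq (N : HypManifold) (x : HypSpace) (q : N) :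
    ∃ y, N.proj y = q ∧ dist x y = dist (N.proj x) q := by
  obtain ⟨y₀, rfl⟩ := N.proj_surjective q
  let S : Set (HypSpace ≃ᵢ HypSpace) := {γ | γ ∈ N.group ∧ dist x (γ y₀) ≤ dist x y₀}
  have hfin : S.Finite := by
    refine (N.discrete y₀ (2 * dist x y₀)).subset ?_
    rintro γ ⟨hγ, h⟩
    refine ⟨hγ, ?_⟩
    have := dist_triangle y₀ x (γ y₀)
    rw [dist_comm y₀ x] at this
    linarith
  obtain ⟨γ, ⟨hγ, -⟩, hmin⟩ := Set.exists_min_image S (fun γ => dist x (γ y₀)) hfin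
    ⟨1, N.group.one_mem, le_rfl⟩
  have hmin' : ∀ γ' ∈ N.group, dist x (γ y₀) ≤ dist x (γ' y₀) := by
    intro γ' hγ'
    by_cases h : dist x (γ' y₀) ≤ dist x y₀
    · exact hmin γ' ⟨hγ', h⟩
    · exact (hmin 1 ⟨N.group.one_mem, le_rfl⟩).trans (not_le.1 h).le
  have hγy : N.proj (γ y₀) = N.proj y₀ := (N.proj_eq_proj.2 ⟨γ, hγ, rfl⟩).symm
  refine ⟨γ y₀, hγy, le_antisymm ?_ ?_⟩
  · refine le_csInf ⟨_, x, y₀, rfl, rfl, rfl⟩ ?_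
    rintro _ ⟨u, v, hu, hv, rfl⟩
    obtain ⟨α, hα, rfl⟩ := N.proj_eq_proj.1 hu
    obtain ⟨β, hβ, rfl⟩ := N.proj_eq_proj.1 hv.symm
    have := hmin' (α * β) (N.group.mul_mem hα hβ)
    rwa [IsometryEquiv.mul_apply, α.isometry.dist_eq] at this
  · rw [← hγy]
    exact N.dist_proj_le _ _

noncomputable instance (N : HypManifold) : MetricSpace N where
  dist_self p := by
    obtain ⟨x, rfl⟩ := N.proj_surjective p
    refine le_antisymm ((N.dist_proj_le x x).trans (dist_self x).le) ?_
    obtain ⟨y, -, h⟩ := N.exists_dist_eq x (N.proj x)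
    exact h ▸ dist_nonneg
  dist_comm p q := by
    have key : ∀ p q : N, dist p q ≤ dist q p := by
      intro p q
      obtain ⟨x, rfl⟩ := N.proj_surjective q
      obtain ⟨y, rfl, h⟩ := N.exists_dist_eq x p
      rw [← h, dist_comm x y]
      exact N.dist_proj_le y x
    exact le_antisymm (key p q) (key q p)
  dist_triangle p q r := by
    obtain ⟨x, rfl⟩ := N.proj_surjective p
    obtain ⟨y, rfl, hy⟩ := N.exists_dist_eq x q
    obtain ⟨z, rfl, hz⟩ := N.exists_dist_eq y r
    rw [← hy, ← hz]
    exact (N.dist_proj_le x z).trans (dist_triangle x y z)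
  eq_of_dist_eq_zero {p q} h := by
    obtain ⟨x, rfl⟩ := N.proj_surjective p
    obtain ⟨y, rfl, hy⟩ := N.exists_dist_eq x q
    rw [h] at hy
    rw [dist_eq_zero.1 hy]

variable (N : HypManifold)

/-- A subset of a hyperbolic manifold is convex if its full preimage in hyperbolic space is
convex. -/
def IsConvex (Q : Set N) : Prop :=
  HypSpace.IsConvex (N.proj ⁻¹' Q)

/-- The injectivity radius of `Q` at a point `p`, in `[0, ∞]`: the supremum of the radii `r` such
that the covering `N.proj ⁻¹' Q → Q` is injective on the part in this covering of the open ball of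
radius `r` about each lift of `p`. For `Q = univ` it is the injectivity radius of the manifold. -/
noncomputable def injRad (Q : Set N) (p : N) : ℝ≥0∞ :=
  ⨆ (r : ℝ≥0) (_ : ∀ x, N.proj x = p → InjOn N.proj (Metric.ball x r ∩ N.proj ⁻¹' Q)), (r : ℝ≥0∞)

/-- The thick part `Q^{≥ ε}`: points of `Q` at which the injectivity radius is at least `ε / 2`. -/
def thick (Q : Set N) (ε : ℝ) : Set N :=
  {p | p ∈ Q ∧ ENNReal.ofReal (ε / 2) ≤ N.injRad Q p}

/-- The thick part `Q^{> ε}`: points of `Q` at which the injectivity radius exceeds `ε / 2`. -/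
def strictThick (Q : Set N) (ε : ℝ) : Set N :=
  {p | p ∈ Q ∧ ENNReal.ofReal (ε / 2) < N.injRad Q p}

end HypManifold

/-- Geometric convergence `(Q m, x m) → (N, x)` of based subsets `Q m` of hyperbolic manifolds `M m`
to a based hyperbolic manifold. For every `R > 0` there are, for all large `m`, smooth embeddings
`g m` of the open ball `B_R(x)` into `M m`, with values in `Q m` and taking `x` to `x m`, that
converge to isometries in the `C^∞` topology. The last condition is expressed on the universal
covers: on the ball of radius `R` about a lift of `x`, the map `g m` lifts to `A m ∘ F m`, where the
`A m` are isometries and the maps `F m` converge to the identity in the `C^∞` topology. -/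
def ConvergesGeometrically (M : ℕ → HypManifold) (Q : ∀ m, Set (M m)) (x' : ∀ m, M m)
    (N : HypManifold) (x : N) : Prop :=
  ∀ R : ℝ, 0 < R →
    ∃ (g : ∀ m, N → M m) (u : HypSpace) (A : ℕ → HypSpace ≃ᵢ HypSpace)
      (F : ℕ → HypSpace → HypSpace),
      N.proj u = x ∧
      (∀ᶠ m in atTop,
        g m x = x' m ∧
        MapsTo (g m) (Metric.ball x R) (Q m) ∧
        InjOn (g m) (Metric.ball x R) ∧
        HypSpace.IsSmoothImmersionOn (F m) (Metric.ball u R) ∧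
        ∀ v ∈ Metric.ball u R, g m (N.proj v) = (M m).proj (A m (F m v))) ∧
      HypSpace.TendstoIdSmoothly F (Metric.ball u R)

/-- A `J`-bilipschitz inclusion of metric spaces (it is automatically injective). -/
def IsBilipschitzInclusion {X X' : Type*} [MetricSpace X] [MetricSpace X'] (J : ℝ)
    (φ : X → X') : Prop :=
  ∀ p q : X, J⁻¹ * dist p q ≤ dist (φ p) (φ q) ∧ dist (φ p) (φ q) ≤ J * dist p q

/-!
Geometric convergence at a fixed scale says that the lift of a chart to hyperbolic space is
uniformly close to an isometry on a large ball, and, being `C^1`-close to the identity up to an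
isometry, covers almost all of that ball (`HypSpace.TendstoIdSmoothly.eventually_surjOn`). This is
all that is used of the smooth structure; it is recorded as `IsApproximation`. Since the chart is
injective, shortest segments and small embedded balls of the target lift back through it. Hence
charts almost preserve distances (`IsApproximation.abs_dist_map_sub_le`), map points of injectivity
radius greater than `ε / 2` to points of injectivity radius at least `ε / 2`
(`IsApproximation.map_mem_thick`), and the injectivity radius is upper semicontinuous along them
(`mem_thick_of_tendsto`). No derivative is needed for the limit map itself.

Given this, let `g n`, `g' n` be charts for `Y` and `Z` with scale tending to infinity and error
tending to zero. For `p` in `Y^{> ε}` the point `φ (g n p)` is eventually defined and stays at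
bounded distance from the base point, so it equals `g' n (q n)` with `q n` in a fixed ball of `Z`.
Closed balls of `Z` are compact, so `q n` has a limit along an ultrafilter fixed in advance, which
replaces the usual diagonal choice of subsequences. Limits of distances give the bilipschitz bounds
for the limit map on `Y^{> ε}`, with the same constant, and it extends to the closure `Y^{≥ ε}`
because `Z^{≥ δ}` is closed in a proper space (`exists_isBilipschitzInclusion_closure`).
-/

/-! ### Hyperbolic balls are Euclidean balls -/

namespace HypSpace

/-- The centre of the Euclidean ball that underlies the hyperbolic ball of radius `r` about `u`. -/
noncomputable def euclidCenter (u : HypSpace) (r : ℝ) : EuclideanSpace ℝ (Fin 3) :=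
  !₂[u.coord 0, u.coord 1, u.coord 2 * Real.cosh r]

theorem cosh_dist (p q : HypSpace) :
    Real.cosh (dist p q) = 1 + dist p.coord q.coord ^ 2 / (2 * (p.coord 2 * q.coord 2)) := by
  have hp := p.pos
  have hq := q.pos
  have h : dist p q = 2 * (dist p q / 2) := by ring
  rw [h, Real.cosh_two_mul, Real.cosh_sq, sinh_half_dist, div_pow, mul_pow,
    Real.sq_sqrt (by positivity)]
  ring

theorem dist_euclidCenter_sq (u p : HypSpace) (r : ℝ) :
    dist p.coord (u.euclidCenter r) ^ 2 = (u.coord 2 * Real.sinh r) ^ 2 +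
      2 * (u.coord 2 * p.coord 2) * (Real.cosh (dist p u) - Real.cosh r) := by
  have hp := p.pos
  have hu := u.pos
  rw [cosh_dist, mul_pow, Real.sinh_sq, euclid_dist_sq, euclid_dist_sq]
  simp only [euclidCenter, PiLp.toLp_apply, Matrix.cons_val]
  field_simp
  ring

theorem coord_pos_of_dist_euclidCenter_le (u : HypSpace) {r : ℝ}
    {v : EuclideanSpace ℝ (Fin 3)} (hv : dist v (u.euclidCenter r) ≤ u.coord 2 * Real.sinh r) :
    0 < v 2 := by
  have hu := u.pos
  have h1 : |v 2 - u.coord 2 * Real.cosh r| ≤ u.coord 2 * Real.sinh r := by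
    refine le_trans ?_ hv
    rw [← sq_le_sq₀ (abs_nonneg _) dist_nonneg, sq_abs, euclid_dist_sq]
    simp only [euclidCenter, PiLp.toLp_apply, Matrix.cons_val]
    nlinarith [sq_nonneg (v 0 - u.coord 0), sq_nonneg (v 1 - u.coord 1)]
  have h2 : 0 < u.coord 2 * (Real.cosh r - Real.sinh r) :=
    mul_pos hu (sub_pos.2 (Real.sinh_lt_cosh r))
  have := (abs_le.1 h1).1
  linarith

theorem dist_euclidCenter_le_iff (u p : HypSpace) {r : ℝ} (hr : 0 ≤ r) :
    dist p.coord (u.euclidCenter r) ≤ u.coord 2 * Real.sinh r ↔ dist p u ≤ r := by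
  have hp := p.pos
  have hu := u.pos
  have hs : 0 ≤ Real.sinh r := Real.sinh_nonneg_iff.2 hr
  have hup := mul_pos hu hp
  have : Real.cosh (dist p u) ≤ Real.cosh r ↔ dist p u ≤ r := by
    rw [Real.cosh_le_cosh, abs_of_nonneg dist_nonneg, abs_of_nonneg hr]
  rw [← sq_le_sq₀ dist_nonneg (by positivity), dist_euclidCenter_sq, ← this]
  constructor <;> intro h <;> nlinarith

theorem dist_euclidCenter_lt_iff (u p : HypSpace) {r : ℝ} (hr : 0 ≤ r) :
    dist p.coord (u.euclidCenter r) < u.coord 2 * Real.sinh r ↔ dist p u < r := by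
  have hp := p.pos
  have hu := u.pos
  have hs : 0 ≤ Real.sinh r := Real.sinh_nonneg_iff.2 hr
  have hup := mul_pos hu hp
  have : Real.cosh (dist p u) < Real.cosh r ↔ dist p u < r := by
    rw [Real.cosh_lt_cosh, abs_of_nonneg dist_nonneg, abs_of_nonneg hr]
  rw [← sq_lt_sq₀ dist_nonneg (by positivity), dist_euclidCenter_sq, ← this]
  constructor <;> intro h <;> nlinarith

theorem coord_image_closedBall (u : HypSpace) {r : ℝ} (hr : 0 ≤ r) :
    coord '' Metric.closedBall u r =
      Metric.closedBall (u.euclidCenter r) (u.coord 2 * Real.sinh r) := by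
  ext v
  simp only [mem_image, Metric.mem_closedBall]
  constructor
  · rintro ⟨p, hp, rfl⟩
    exact (dist_euclidCenter_le_iff u p hr).2 hp
  · intro hv
    exact ⟨⟨v, coord_pos_of_dist_euclidCenter_le u hv⟩,
      (dist_euclidCenter_le_iff u ⟨v, _⟩ hr).1 hv, rfl⟩

theorem coord_image_ball (u : HypSpace) {r : ℝ} (hr : 0 ≤ r) :
    coord '' Metric.ball u r =
      Metric.ball (u.euclidCenter r) (u.coord 2 * Real.sinh r) := by
  ext v
  simp only [mem_image, Metric.mem_ball]
  constructor
  · rintro ⟨p, hp, rfl⟩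
    exact (dist_euclidCenter_lt_iff u p hr).2 hp
  · intro hv
    exact ⟨⟨v, coord_pos_of_dist_euclidCenter_le u hv.le⟩,
      (dist_euclidCenter_lt_iff u ⟨v, _⟩ hr).1 hv, rfl⟩

theorem isOpen_coord_image_ball (u : HypSpace) {r : ℝ} (hr : 0 ≤ r) :
    IsOpen (coord '' Metric.ball u r) := by
  rw [coord_image_ball u hr]
  exact Metric.isOpen_ball

theorem isCompact_coord_image_closedBall (u : HypSpace) {r : ℝ} (hr : 0 ≤ r) :
    IsCompact (coord '' Metric.closedBall u r) := by
  rw [coord_image_closedBall u hr]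
  exact isCompact_closedBall _ _

theorem coord_injective : Function.Injective coord := fun _ _ => HypSpace.ext

/-- On a compact part of the upper half-space, Euclidean proximity forces hyperbolic proximity. -/
theorem exists_dist_le_of_dist_coord_le {K : Set (EuclideanSpace ℝ (Fin 3))} (hK : IsCompact K)
    (hpos : ∀ v ∈ K, 0 < v 2) {η : ℝ} (hη : 0 < η) :
    ∃ τ > 0, ∀ p q : HypSpace, p.coord ∈ K → dist q.coord p.coord ≤ τ → dist q p ≤ η := by
  obtain ⟨c, hc, hcK⟩ : ∃ c > 0, ∀ v ∈ K, c ≤ v 2 := by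
    rcases K.eq_empty_or_nonempty with rfl | hne
    · exact ⟨1, one_pos, by simp⟩
    · obtain ⟨w, hw, hmin⟩ := hK.exists_isMinOn hne
        (f := fun v : EuclideanSpace ℝ (Fin 3) => v 2) (by fun_prop)
      exact ⟨w 2, hpos w hw, fun v hv => hmin hv⟩
  refine ⟨min (c / 2) (c * η / 2), by positivity, fun p q hp hpq => ?_⟩
  have hp2 := hcK _ hp
  have hq2 : c / 2 ≤ q.coord 2 := by
    have h1 : |q.coord 2 - p.coord 2| ≤ dist q.coord p.coord := by
      rw [← sq_le_sq₀ (abs_nonneg _) dist_nonneg, sq_abs, euclid_dist_sq]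
      nlinarith [sq_nonneg (q.coord 0 - p.coord 0), sq_nonneg (q.coord 1 - p.coord 1)]
    have h2 := (abs_le.1 h1).1
    have h3 := hpq.trans (min_le_left _ _)
    linarith
  have hsq : c / 2 ≤ √(q.coord 2 * p.coord 2) := by
    apply Real.le_sqrt_of_sq_le
    nlinarith
  have hsinh : Real.sinh (dist q p / 2) ≤ Real.sinh (η / 2) := by
    refine le_trans ?_ (Real.self_le_sinh_iff.2 (by positivity : 0 ≤ η / 2))
    rw [sinh_half_dist, div_le_iff₀ (by linarith)]
    have h3 := hpq.trans (min_le_right _ _)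
    nlinarith
  have := Real.sinh_le_sinh.1 hsinh
  linarith

instance : ProperSpace HypSpace := by
  refine .of_isCompact_closedBall_of_le 0 fun u r hr => ?_
  have hK := isCompact_coord_image_closedBall u hr
  have hpos : ∀ v ∈ coord '' Metric.closedBall u r, 0 < v 2 := by
    rintro _ ⟨p, -, rfl⟩
    exact p.pos
  have : Metric.closedBall u r = (fun v : coord '' Metric.closedBall u r =>
      (⟨v, hpos v v.2⟩ : HypSpace)) '' univ := by
    ext p
    constructor
    · exact fun hp => ⟨⟨p.coord, p, hp, rfl⟩, trivial, rfl⟩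
    · rintro ⟨⟨_, q, hq, rfl⟩, -, rfl⟩
      exact hq
  rw [this]
  have : CompactSpace (coord '' Metric.closedBall u r) := isCompact_iff_compactSpace.1 hK
  refine isCompact_univ.image (Metric.continuous_iff.2 fun v η hη => ?_)
  obtain ⟨τ, hτ, h⟩ := exists_dist_le_of_dist_coord_le hK hpos (half_pos hη)
  exact ⟨τ, hτ, fun w hw => (h ⟨v, hpos v v.2⟩ ⟨w, hpos w w.2⟩ v.2 hw.le).trans_lt
    (half_lt_self hη)⟩

/-! ### Smooth convergence to the identity -/

theorem inCoords_coord (F : HypSpace → HypSpace) (p : HypSpace) :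
    inCoords F p.coord = (F p).coord := by
  simp [inCoords, p.pos]

theorem TendstoIdSmoothly.eventually_dist_coord_le {F : ℕ → HypSpace → HypSpace}
    {B : Set HypSpace} (hF : TendstoIdSmoothly F B) {K : Set HypSpace} (hKB : K ⊆ B)
    (hK : IsCompact (coord '' K)) {τ : ℝ} (hτ : 0 < τ) :
    ∀ᶠ m in atTop, ∀ v ∈ K, dist (F m v).coord v.coord ≤ τ := by
  have h := Metric.tendstoUniformlyOn_iff.1 (hF 0 _ (image_mono hKB) hK) τ hτ
  filter_upwards [h] with m hm v hv
  have h1 := (hm _ (mem_image_of_mem coord hv)).le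
  rw [dist_comm] at h1
  refine le_trans (le_of_eq ?_) h1
  rw [dist_eq_norm, dist_eq_norm, iteratedFDeriv_zero_eq_comp, iteratedFDeriv_zero_eq_comp,
    Function.comp_apply, Function.comp_apply, ← map_sub, LinearIsometryEquiv.norm_map,
    inCoords_coord, id]

theorem TendstoIdSmoothly.eventually_norm_fderiv_sub_le {F : ℕ → HypSpace → HypSpace}
    {B : Set HypSpace} (hF : TendstoIdSmoothly F B) {K : Set HypSpace} (hKB : K ⊆ B)
    (hK : IsCompact (coord '' K)) {τ : ℝ} (hτ : 0 < τ) :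
    ∀ᶠ m in atTop, ∀ v ∈ coord '' K,
      ‖fderiv ℝ (inCoords (F m)) v - ContinuousLinearMap.id ℝ _‖ ≤ τ := by
  have h := Metric.tendstoUniformlyOn_iff.1 (hF 1 _ (image_mono hKB) hK) τ hτ
  filter_upwards [h] with m hm v hv
  have h1 := (hm v hv).le
  rw [dist_comm, dist_eq_norm] at h1
  refine ContinuousLinearMap.opNorm_le_bound _ hτ.le fun w => ?_
  have h2 := ContinuousMultilinearMap.le_of_opNorm_le h1 (fun _ : Fin 1 => w)
  simpa [iteratedFDeriv_one_apply] using h2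

theorem TendstoIdSmoothly.eventually_dist_le {F : ℕ → HypSpace → HypSpace} {u : HypSpace}
    {R r : ℝ} (hF : TendstoIdSmoothly F (Metric.ball u R)) (hr : 0 ≤ r) (hrR : r < R) {η : ℝ}
    (hη : 0 < η) : ∀ᶠ m in atTop, ∀ v ∈ Metric.closedBall u r, dist (F m v) v ≤ η := by
  have hK := isCompact_coord_image_closedBall u hr
  obtain ⟨τ, hτ, h⟩ := exists_dist_le_of_dist_coord_le hK
    (by rintro _ ⟨p, -, rfl⟩; exact p.pos) hη
  filter_upwards [hF.eventually_dist_coord_le (Metric.closedBall_subset_ball hrR) hK hτ]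
    with m hm v hv
  exact h v (F m v) (mem_image_of_mem _ hv) (hm v hv)

/-- Smooth maps that are `C^1`-close to the identity on a ball cover every smaller ball: near the
identity such a map is a Lipschitz perturbation of the identity, so it maps each Euclidean ball of
some fixed radius `ρ` about a point `w` onto a neighbourhood of `w`. -/
theorem TendstoIdSmoothly.eventually_surjOn {F : ℕ → HypSpace → HypSpace} {u : HypSpace}
    {R r s : ℝ} (hF : TendstoIdSmoothly F (Metric.ball u R)) (hr : 0 ≤ r) (hrs : r < s)
    (hsR : s < R) (hsmooth : ∀ᶠ m in atTop, IsSmoothImmersionOn (F m) (Metric.ball u R)) :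
    ∀ᶠ m in atTop, SurjOn (F m) (Metric.ball u s) (Metric.closedBall u r) := by
  have hs : 0 ≤ s := hr.trans hrs.le
  have hKr := isCompact_coord_image_closedBall u hr
  have hKs := isCompact_coord_image_closedBall u hs
  obtain ⟨ρ, hρ, hρs⟩ := hKr.exists_cthickening_subset_open (isOpen_coord_image_ball u hs)
    (image_mono (Metric.closedBall_subset_ball hrs))
  filter_upwards [hsmooth,
    hF.eventually_dist_coord_le (Metric.closedBall_subset_ball (hrs.trans hsR)) hKr
      (by positivity : 0 < ρ / 2),
    hF.eventually_norm_fderiv_sub_le (Metric.closedBall_subset_ball hsR) hKs one_half_pos]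
    with m hm hclose hderiv w hw
  have hball : Metric.closedBall w.coord ρ ⊆ coord '' Metric.ball u s :=
    (Metric.closedBall_subset_cthickening (mem_image_of_mem _ hw) ρ).trans hρs
  have happrox : ApproximatesLinearOn (inCoords (F m)) (ContinuousLinearMap.id ℝ _)
      (Metric.closedBall w.coord ρ) (1 / 2 : ℝ≥0) := by
    intro a ha b hb
    refine (convex_closedBall w.coord ρ).norm_image_sub_le_of_norm_hasFDerivWithin_le' (𝕜 := ℝ)
      (f' := fderiv ℝ (inCoords (F m))) (fun v hv => ?_) (fun v hv => ?_) hb ha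
    · have hv' : v ∈ coord '' Metric.ball u R :=
        image_mono (Metric.ball_subset_ball hsR.le) (hball hv)
      have hopen := isOpen_coord_image_ball u (hs.trans hsR.le)
      exact ((hm.1.contDiffAt (hopen.mem_nhds hv')).differentiableAt
        (by simp)).hasFDerivAt.hasFDerivWithinAt
    · simpa using hderiv v (image_mono Metric.ball_subset_closedBall (hball hv))
  let inv : (ContinuousLinearMap.id ℝ (EuclideanSpace ℝ (Fin 3))).NonlinearRightInverse :=
    { toFun := id, nnnorm := 1, bound' := by simp, right_inv' := by simp }
  have hsurj := happrox.surjOn_closedBall_of_nonlinearRightInverse inv hρ.le Subset.rfl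
  have hmem : w.coord ∈ Metric.closedBall (inCoords (F m) w.coord)
      (((inv.nnnorm : ℝ)⁻¹ - (1 / 2 : ℝ≥0)) * ρ) := by
    rw [Metric.mem_closedBall, dist_comm, inCoords_coord]
    refine (hclose w hw).trans (le_of_eq ?_)
    simp only [inv]
    push_cast
    ring
  obtain ⟨v, hv, hvw⟩ := hsurj hmem
  obtain ⟨p, hp, rfl⟩ := hball hv
  exact ⟨p, hp, coord_injective (by rw [← inCoords_coord, hvw])⟩

end HypSpace

/-! ### Closed balls and thick parts in hyperbolic manifolds -/

namespace HypManifold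

theorem proj_smul (N : HypManifold) {γ : HypSpace ≃ᵢ HypSpace} (hγ : γ ∈ N.group)
    (x : HypSpace) : N.proj (γ x) = N.proj x :=
  (N.proj_eq_proj.2 ⟨γ, hγ, rfl⟩).symm

theorem lipschitzWith_proj (N : HypManifold) : LipschitzWith 1 N.proj :=
  LipschitzWith.of_dist_le_mul fun x y => by simpa using N.dist_proj_le x y

theorem exists_mem_closedBall (N : HypManifold) (x : HypSpace) {q : N} {r : ℝ}
    (hq : dist (N.proj x) q ≤ r) : ∃ y ∈ Metric.closedBall x r, N.proj y = q := by
  obtain ⟨y, hy, h⟩ := N.exists_dist_eq x q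
  exact ⟨y, by rwa [Metric.mem_closedBall, dist_comm, h], hy⟩

instance (N : HypManifold) : ProperSpace N := by
  refine ⟨fun p r => ?_⟩
  obtain ⟨x, rfl⟩ := N.proj_surjective p
  have : Metric.closedBall (N.proj x) r = N.proj '' Metric.closedBall x r := by
    ext q
    constructor
    · intro hq
      exact N.exists_mem_closedBall x (by rwa [dist_comm])
    · rintro ⟨y, hy, rfl⟩
      exact (N.dist_proj_le y x).trans hy
  rw [this]
  exact (isCompact_closedBall x r).image N.lipschitzWith_proj.continuous

/-- Injectivity of the covering on a ball about one lift of a point passes to all lifts, by deck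
transformations. -/
theorem injOn_ball_of_proj_eq (N : HypManifold) {Q : Set N} {x x' : HypSpace} {r : ℝ}
    (h : InjOn N.proj (Metric.ball x r ∩ N.proj ⁻¹' Q)) (hx : N.proj x = N.proj x') :
    InjOn N.proj (Metric.ball x' r ∩ N.proj ⁻¹' Q) := by
  obtain ⟨γ, hγ, rfl⟩ := N.proj_eq_proj.1 hx
  have key : ∀ a ∈ Metric.ball (γ x) r ∩ N.proj ⁻¹' Q,
      γ⁻¹ a ∈ Metric.ball x r ∩ N.proj ⁻¹' Q := by
    rintro a ⟨ha, haQ⟩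
    refine ⟨?_, by rwa [mem_preimage, N.proj_smul (N.group.inv_mem hγ)]⟩
    rw [Metric.mem_ball] at ha ⊢
    rwa [← γ.isometry.dist_eq, show γ (γ⁻¹ a) = a from γ.apply_symm_apply a]
  intro a ha b hb hab
  refine γ⁻¹.injective (h (key a ha) (key b hb) ?_)
  rwa [N.proj_smul (N.group.inv_mem hγ), N.proj_smul (N.group.inv_mem hγ)]

theorem injOn_of_lt_injRad (N : HypManifold) {Q : Set N} {x : HypSpace} {r : ℝ}
    (h : ENNReal.ofReal r < N.injRad Q (N.proj x)) :
    ∃ s > r, InjOn N.proj (Metric.ball x s ∩ N.proj ⁻¹' Q) := by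
  simp only [injRad, lt_iSup_iff] at h
  obtain ⟨s, hs, hrs⟩ := h
  refine ⟨s, ?_, hs x rfl⟩
  rw [ENNReal.ofReal, ENNReal.coe_lt_coe] at hrs
  exact (Real.le_coe_toNNReal r).trans_lt (NNReal.coe_lt_coe.2 hrs)

theorem ofReal_le_injRad (N : HypManifold) {Q : Set N} {x : HypSpace} {r : ℝ} (hr : 0 ≤ r)
    (h : InjOn N.proj (Metric.ball x r ∩ N.proj ⁻¹' Q)) :
    ENNReal.ofReal r ≤ N.injRad Q (N.proj x) := by
  refine le_iSup₂_of_le r.toNNReal (fun x' hx' => ?_) le_rfl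
  rw [Real.coe_toNNReal r hr]
  exact N.injOn_ball_of_proj_eq h hx'.symm

/-- The injectivity radius is a supremum, so being at least `δ / 2` means injectivity of the
covering on the open ball of radius `δ / 2` itself. -/
theorem injOn_of_mem_thick (N : HypManifold) {Q : Set N} {x : HypSpace} {δ : ℝ} (hδ : 0 < δ)
    (h : N.proj x ∈ N.thick Q δ) :
    InjOn N.proj (Metric.ball x (δ / 2) ∩ N.proj ⁻¹' Q) := by
  intro a ha b hb hab
  obtain ⟨r, hr, hrδ⟩ := exists_between (max_lt (max_lt ha.1 hb.1) (half_pos hδ))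
  have hlt : ENNReal.ofReal r < N.injRad Q (N.proj x) :=
    ((ENNReal.ofReal_lt_ofReal_iff (half_pos hδ)).2 hrδ).trans_le h.2
  obtain ⟨s, hs, hinj⟩ := N.injOn_of_lt_injRad hlt
  have hmax := (max_lt_iff.1 hr).1
  exact hinj ⟨(max_lt_iff.1 hmax).1.trans hs, ha.2⟩ ⟨(max_lt_iff.1 hmax).2.trans hs, hb.2⟩ hab

theorem isClosed_thick_univ (N : HypManifold) {δ : ℝ} (hδ : 0 < δ) :
    IsClosed (N.thick univ δ) := by
  refine isClosed_of_closure_subset fun p hp => ?_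
  obtain ⟨w, rfl⟩ := N.proj_surjective p
  refine ⟨trivial, N.ofReal_le_injRad (half_pos hδ).le ?_⟩
  rintro a ⟨ha, -⟩ b ⟨hb, -⟩ hab
  rw [Metric.mem_ball] at ha hb
  obtain ⟨q, hq, hwq⟩ := Metric.mem_closure_iff.1 hp (δ / 2 - max (dist a w) (dist b w))
    (sub_pos.2 (max_lt ha hb))
  obtain ⟨v, rfl, hv⟩ := N.exists_dist_eq w q
  refine N.injOn_of_mem_thick hδ hq ⟨?_, trivial⟩ ⟨?_, trivial⟩ hab <;> rw [Metric.mem_ball]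
  · linarith [dist_triangle a w v, le_max_left (dist a w) (dist b w)]
  · linarith [dist_triangle b w v, le_max_right (dist a w) (dist b w)]

end HypManifold

/-! ### Approximations of a manifold by another -/

/-- A coarse form of one stage of geometric convergence. The map `g`, defined on the `R`-ball about
`x` with values in `Q`, lifts to a map `h` of the `R`-ball about the lift `u` of `x` which preserves
distances up to the error `η` and covers the ball of radius `R - η` about `h u`. -/
structure IsApproximation (M : HypManifold) (Q : Set M) (x' : M) (N : HypManifold) (x : N)
    (R η : ℝ) (g : N → M) (u : HypSpace) (h : HypSpace → HypSpace) : Prop where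
  proj_base : N.proj u = x
  map_base : g x = x'
  mapsTo : MapsTo g (Metric.ball x R) Q
  injOn : InjOn g (Metric.ball x R)
  map_proj : ∀ v ∈ Metric.ball u R, g (N.proj v) = M.proj (h v)
  dist_le : ∀ a ∈ Metric.ball u R, ∀ b ∈ Metric.ball u R, |dist (h a) (h b) - dist a b| ≤ η
  surjOn : SurjOn h (Metric.ball u R) (Metric.closedBall (h u) (R - η))

/-- Geometric convergence provides approximations of every scale and every precision. -/
theorem ConvergesGeometrically.eventually_isApproximation {M : ℕ → HypManifold}
    {Q : ∀ m, Set (M m)} {x' : ∀ m, M m} {N : HypManifold} {x : N}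
    (hconv : ConvergesGeometrically M Q x' N x) {R η : ℝ} (hR : 0 < R) (hη : 0 < η) (hηR : η ≤ R) :
    ∀ᶠ m in atTop, ∃ g u h, IsApproximation (M m) (Q m) (x' m) N x R η g u h := by
  obtain ⟨g, u, A, F, hu, hg, hF⟩ := hconv (R + 1) (by linarith)
  have hsub : Metric.ball u R ⊆ Metric.ball u (R + 1) := Metric.ball_subset_ball (by linarith)
  have hsubx : Metric.ball x R ⊆ Metric.ball x (R + 1) := Metric.ball_subset_ball (by linarith)
  filter_upwards [hg, hF.eventually_dist_le hR.le (lt_add_one R) (half_pos hη),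
    hF.eventually_surjOn (r := R - η / 2) (s := R) (by linarith) (by linarith) (by linarith)
      (hg.mono fun m hm => hm.2.2.2.1)]
    with m ⟨hbase, hmaps, hinj, _, hproj⟩ hclose hsurj
  have hclose' : ∀ a ∈ Metric.ball u R, dist (F m a) a ≤ η / 2 :=
    fun a ha => hclose a (Metric.ball_subset_closedBall ha)
  refine ⟨g m, u, fun v => A m (F m v), hu, hbase, hmaps.mono_left hsubx, hinj.mono hsubx,
    fun v hv => hproj v (hsub hv), fun a ha b hb => ?_, fun w hw => ?_⟩
  · rw [(A m).isometry.dist_eq, ← Real.dist_eq]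
    refine (dist_dist_dist_le _ _ _ _).trans ?_
    linarith [hclose' a ha, hclose' b hb]
  · have hmem : (A m).symm w ∈ Metric.closedBall u (R - η / 2) := by
      have h1 : dist ((A m).symm w) (F m u) ≤ R - η := by
        rw [← (A m).isometry.dist_eq, (A m).apply_symm_apply]
        exact hw
      have h2 := hclose' u (Metric.mem_ball_self hR)
      rw [Metric.mem_closedBall]
      linarith [dist_triangle ((A m).symm w) (F m u) u]
    obtain ⟨v, hv, hvw⟩ := hsurj hmem
    exact ⟨v, hv, (congrArg (A m) hvw).trans ((A m).apply_symm_apply w)⟩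

namespace IsApproximation

variable {M : HypManifold} {Q : Set M} {x' : M} {N : HypManifold} {x : N} {R η : ℝ} {g : N → M}
  {u : HypSpace} {h : HypSpace → HypSpace}

theorem proj_mem (H : IsApproximation M Q x' N x R η g u h) {v : HypSpace}
    (hv : v ∈ Metric.ball u R) : N.proj v ∈ Metric.ball x R := by
  rw [← H.proj_base]
  exact (N.dist_proj_le v u).trans_lt hv

theorem proj_eq_of_proj_eq (H : IsApproximation M Q x' N x R η g u h) {a b : HypSpace}
    (ha : a ∈ Metric.ball u R) (hb : b ∈ Metric.ball u R) (hab : M.proj (h a) = M.proj (h b)) :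
    N.proj a = N.proj b :=
  H.injOn (H.proj_mem ha) (H.proj_mem hb) (by rw [H.map_proj a ha, H.map_proj b hb, hab])

theorem dist_lift_le (H : IsApproximation M Q x' N x R η g u h) {a b : HypSpace}
    (ha : a ∈ Metric.ball u R) (hb : b ∈ Metric.ball u R) : dist (h a) (h b) ≤ dist a b + η := by
  linarith [(abs_le.1 (H.dist_le a ha b hb)).2]

theorem le_dist_lift (H : IsApproximation M Q x' N x R η g u h) {a b : HypSpace}
    (ha : a ∈ Metric.ball u R) (hb : b ∈ Metric.ball u R) : dist a b ≤ dist (h a) (h b) + η := by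
  linarith [(abs_le.1 (H.dist_le a ha b hb)).1]

theorem exists_lift (H : IsApproximation M Q x' N x R η g u h) {r : ℝ} (hrR : r < R) {a : N}
    (ha : dist a x ≤ r) : ∃ v ∈ Metric.closedBall u r, v ∈ Metric.ball u R ∧ N.proj v = a := by
  rw [← H.proj_base, dist_comm] at ha
  obtain ⟨v, hv, hva⟩ := N.exists_mem_closedBall u ha
  exact ⟨v, hv, Metric.closedBall_subset_ball hrR hv, hva⟩

/-- Well inside its domain, an approximation distorts distances by at most `η`. The lower bound
lifts a shortest segment of `M`; it stays in the region that `h` covers. -/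
theorem abs_dist_map_sub_le (H : IsApproximation M Q x' N x R η g u h) (hη : 0 < η) {r : ℝ}
    (hr : 3 * r + 3 * η ≤ R) {a b : N} (ha : dist a x ≤ r) (hb : dist b x ≤ r) :
    |dist (g a) (g b) - dist a b| ≤ η := by
  have hr0 : 0 ≤ r := dist_nonneg.trans ha
  obtain ⟨v, hvr, hv, rfl⟩ := H.exists_lift (by linarith) ha
  rw [Metric.mem_closedBall] at hvr
  obtain ⟨w, rfl, hvw⟩ := N.exists_dist_eq v b
  have hle : dist v w ≤ 2 * r := by
    rw [hvw]
    linarith [dist_triangle_right (N.proj v) (N.proj w) x]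
  have hw : w ∈ Metric.ball u R := by
    rw [Metric.mem_ball]
    linarith [dist_triangle_left w u v]
  have hu : u ∈ Metric.ball u R := Metric.mem_ball_self (by linarith)
  rw [H.map_proj v hv, H.map_proj w hw]
  have hupper : dist (M.proj (h v)) (M.proj (h w)) ≤ dist (N.proj v) (N.proj w) + η := by
    rw [← hvw]
    exact (M.dist_proj_le _ _).trans (H.dist_lift_le hv hw)
  obtain ⟨c, hc, hvc⟩ := M.exists_dist_eq (h v) (M.proj (h w))
  have hcmem : c ∈ Metric.closedBall (h u) (R - η) := by
    rw [Metric.mem_closedBall]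
    linarith [dist_triangle_left c (h u) (h v), H.dist_lift_le hv hu]
  obtain ⟨w', hw', rfl⟩ := H.surjOn hcmem
  have hlower : dist (N.proj v) (N.proj w) ≤ dist (M.proj (h v)) (M.proj (h w)) + η := by
    rw [← hvc, ← H.proj_eq_of_proj_eq hw' hw hc]
    exact (N.dist_proj_le _ _).trans (H.le_dist_lift hv hw')
  exact abs_le.2 ⟨by linarith, by linarith⟩

theorem exists_map_eq (H : IsApproximation M Q x' N x R η g u h) (hη : 0 < η) {r : ℝ} {p : M}
    (hp : dist p x' ≤ r) (hr : r + η ≤ R) : ∃ q : N, dist q x ≤ r + η ∧ g q = p := by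
  have hu : u ∈ Metric.ball u R :=
    Metric.mem_ball_self (by linarith [dist_nonneg.trans hp])
  have hx' : M.proj (h u) = x' := by
    rw [← H.map_proj u hu, H.proj_base, H.map_base]
  rw [← hx', dist_comm] at hp
  obtain ⟨c, hc, rfl⟩ := M.exists_mem_closedBall (h u) hp
  obtain ⟨v, hv, rfl⟩ := H.surjOn (Metric.closedBall_subset_closedBall (by linarith) hc)
  refine ⟨N.proj v, ?_, H.map_proj v hv⟩
  rw [← H.proj_base]
  rw [Metric.mem_closedBall] at hc
  linarith [N.dist_proj_le v u, H.le_dist_lift hv hu]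

/-- A sufficiently fine approximation maps a point with injectivity radius greater than `ε / 2` to
a point with injectivity radius at least `ε / 2`. -/
theorem map_mem_thick (H : IsApproximation M Q x' N x R η g u h) (hη : 0 < η) {ε r s : ℝ}
    (hε : 0 < ε) {v : HypSpace} (hv : dist (N.proj v) x ≤ r)
    (hinj : InjOn N.proj (Metric.ball v s)) (hs : ε / 2 + η < s) (hR : r + ε / 2 + 2 * η ≤ R) :
    g (N.proj v) ∈ M.thick Q ε := by
  have hr0 : 0 ≤ r := dist_nonneg.trans hv
  have hu : u ∈ Metric.ball u R := Metric.mem_ball_self (by linarith)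
  obtain ⟨w, hwr, hw, hwv⟩ := H.exists_lift (by linarith) hv
  rw [Metric.mem_closedBall] at hwr
  have hinj' : InjOn N.proj (Metric.ball w s) := by
    have := N.injOn_ball_of_proj_eq (Q := univ) (by simpa using hinj) hwv.symm
    simpa using this
  refine ⟨H.mapsTo (show N.proj v ∈ Metric.ball x R by rw [Metric.mem_ball]; linarith), ?_⟩
  rw [← hwv, H.map_proj w hw]
  refine M.ofReal_le_injRad (by positivity) ?_
  have key : ∀ c ∈ Metric.ball (h w) (ε / 2), ∃ a ∈ Metric.ball u R, a ∈ Metric.ball w s ∧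
      h a = c := by
    intro c hc
    rw [Metric.mem_ball] at hc
    have hcmem : c ∈ Metric.closedBall (h u) (R - η) := by
      rw [Metric.mem_closedBall]
      linarith [dist_triangle c (h w) (h u), H.dist_lift_le hw hu]
    obtain ⟨a, ha, rfl⟩ := H.surjOn hcmem
    refine ⟨a, ha, ?_, rfl⟩
    rw [Metric.mem_ball]
    linarith [H.le_dist_lift ha hw]
  rintro c ⟨hc, -⟩ d ⟨hd, -⟩ hcd
  obtain ⟨a, ha, has, rfl⟩ := key c hc
  obtain ⟨b, hb, hbs, rfl⟩ := key d hd
  rw [hinj' has hbs (H.proj_eq_of_proj_eq ha hb hcd)]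

/-- Let the approximation map some point `t`-close to `N.proj w` to a point with injectivity radius
at least `δ / 2`. Then two points near `w` with the same projection are `η`-close, because the lift
of the approximation identifies them. -/
theorem dist_le_of_map_mem_thick (H : IsApproximation M Q x' N x R η g u h)
    {δ r s t : ℝ} (hδ : 0 < δ) {q : N} {w a b : HypSpace} (hthick : g q ∈ M.thick Q δ)
    (hw : dist (N.proj w) x ≤ r) (hqw : dist (N.proj w) q ≤ t) (ha : a ∈ Metric.ball w s)
    (hb : b ∈ Metric.ball w s) (hs : s + t + η ≤ δ / 2) (hR : r + s + t ≤ R)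
    (hab : N.proj a = N.proj b) : dist a b ≤ η := by
  have hs0 : 0 < s := dist_nonneg.trans_lt ha
  have ht0 : 0 ≤ t := dist_nonneg.trans hqw
  -- A deck transformation moves `w` close to the lift `u` of the base point.
  obtain ⟨w', hw', hww'⟩ : ∃ w' ∈ Metric.closedBall u r, N.proj w' = N.proj w := by
    rw [← H.proj_base, dist_comm] at hw
    exact N.exists_mem_closedBall u hw
  obtain ⟨γ, hγ, rfl⟩ := N.proj_eq_proj.1 hww'.symm
  rw [← hww'] at hqw
  obtain ⟨v, hv, rfl⟩ := N.exists_mem_closedBall (γ w) hqw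
  rw [Metric.mem_closedBall] at hw' hv
  have hvR : v ∈ Metric.ball u R := by
    rw [Metric.mem_ball]
    linarith [dist_triangle v (γ w) u]
  rw [H.map_proj v hvR] at hthick
  have key : ∀ c ∈ Metric.ball w s, γ c ∈ Metric.ball u R ∧
      h (γ c) ∈ Metric.ball (h v) (δ / 2) ∩ M.proj ⁻¹' Q := by
    intro c hc
    rw [Metric.mem_ball, ← γ.isometry.dist_eq] at hc
    have hcR : γ c ∈ Metric.ball u R := by
      rw [Metric.mem_ball]
      linarith [dist_triangle (γ c) (γ w) u]
    refine ⟨hcR, ?_, ?_⟩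
    · rw [Metric.mem_ball]
      linarith [H.dist_lift_le hcR hvR, dist_triangle_right (γ c) v (γ w)]
    · rw [mem_preimage, ← H.map_proj _ hcR]
      exact H.mapsTo (H.proj_mem hcR)
  obtain ⟨haR, ha'⟩ := key a ha
  obtain ⟨hbR, hb'⟩ := key b hb
  have heq : h (γ a) = h (γ b) := M.injOn_of_mem_thick hδ hthick ha' hb' (by
    rw [← H.map_proj _ haR, ← H.map_proj _ hbR, N.proj_smul hγ, N.proj_smul hγ, hab])
  simpa [heq, γ.isometry.dist_eq] using H.le_dist_lift haR hbR

end IsApproximation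

/-! ### Limits of bilipschitz maps -/

theorem Ultrafilter.exists_tendsto_of_dist_le {ι X : Type*} [PseudoMetricSpace X] [ProperSpace X]
    (U : Ultrafilter ι) {f : ι → X} {c : X} {C : ℝ} (h : ∀ᶠ i in (U : Filter ι), dist (f i) c ≤ C) :
    ∃ q, Tendsto f U (𝓝 q) := by
  obtain ⟨q, -, hq⟩ := (isCompact_closedBall c C).ultrafilter_le_nhds' (U.map f) h
  exact ⟨q, hq⟩

/-- A bilipschitz map into a closed subset `T` of a proper space extends to the closure of its
domain, with the same constant. -/
theorem exists_isBilipschitzInclusion_closure {X X' : Type*} [MetricSpace X] [MetricSpace X']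
    [ProperSpace X'] {S : Set X} {T : Set X'} (hT : IsClosed T) {J : ℝ} (hJ : 0 ≤ J) (f : S → T)
    (hf : IsBilipschitzInclusion J f) : ∃ ψ : closure S → T, IsBilipschitzInclusion J ψ := by
  obtain ⟨U, hU⟩ := Ultrafilter.exists_le (atTop : Filter ℕ)
  have hseq : ∀ p : closure S, ∃ s : ℕ → S, Tendsto (fun k => (s k : X)) atTop (𝓝 (p : X)) := by
    intro p
    obtain ⟨s, hs, hp⟩ := mem_closure_iff_seq_limit.1 p.2
    exact ⟨fun k => ⟨s k, hs k⟩, hp⟩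
  choose s hs using hseq
  have hlim : ∀ p, ∃ q, Tendsto (fun k => (f (s p k) : X')) U (𝓝 q) := by
    intro p
    refine U.exists_tendsto_of_dist_le (c := f (s p 0)) (C := J * (dist (p : X) (s p 0) + 1))
      (hU ?_)
    filter_upwards [(hs p).dist tendsto_const_nhds |>.eventually_le_const (lt_add_one _)]
      with k hk
    exact (hf _ _).2.trans (mul_le_mul_of_nonneg_left hk hJ)
  choose ψ hψ using hlim
  refine ⟨fun p => ⟨ψ p, hT.mem_of_tendsto (hψ p) (Eventually.of_forall fun k => (f _).2)⟩,
    fun p p' => ?_⟩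
  have h1 : Tendsto (fun k => dist (s p k : X) (s p' k)) U (𝓝 (dist (p : X) p')) :=
    ((hs p).dist (hs p')).mono_left hU
  have h2 := (hψ p).dist (hψ p')
  exact ⟨le_of_tendsto_of_tendsto' (h1.const_mul _) h2 fun k => (hf _ _).1,
    le_of_tendsto_of_tendsto' h2 (h1.const_mul _) fun k => (hf _ _).2⟩

/-! ### Sequences of finer and finer approximations -/

section Sequence

variable {M : ℕ → HypManifold} {Q : ∀ n, Set (M n)} {x' : ∀ n, M n} {N : HypManifold} {x : N}
  {R η : ℕ → ℝ} {g : ∀ n, N → M n} {u : ℕ → HypSpace} {h : ℕ → HypSpace → HypSpace}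

/-- Approximations preserve limits of distances between points that stay at bounded distance from
the base point. -/
theorem tendsto_dist_map_sub (H : ∀ n, IsApproximation (M n) (Q n) (x' n) N x (R n) (η n) (g n)
      (u n) (h n)) (hη : ∀ n, 0 < η n) (hη0 : Tendsto η atTop (𝓝 0)) (hR : Tendsto R atTop atTop)
    {l : Filter ℕ} (hl : l ≤ atTop) {a b : ℕ → N} {r : ℝ} (ha : ∀ᶠ n in l, dist (a n) x ≤ r)
    (hb : ∀ᶠ n in l, dist (b n) x ≤ r) :
    Tendsto (fun n => dist (g n (a n)) (g n (b n)) - dist (a n) (b n)) l (𝓝 0) := by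
  refine squeeze_zero_norm' ?_ (hη0.mono_left hl)
  filter_upwards [ha, hb, hl (hR.eventually_ge_atTop (3 * r + 3)),
    hl (hη0.eventually_le_const one_pos)] with n ha hb hR hη1
  exact (H n).abs_dist_map_sub_le (hη n) (by linarith) ha hb

theorem eventually_map_mem_thick (H : ∀ n, IsApproximation (M n) (Q n) (x' n) N x (R n) (η n) (g n)
      (u n) (h n)) (hη : ∀ n, 0 < η n) (hη0 : Tendsto η atTop (𝓝 0)) (hR : Tendsto R atTop atTop)
    {ε : ℝ} (hε : 0 < ε) {p : N} (hp : p ∈ N.strictThick univ ε) :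
    ∀ᶠ n in atTop, g n p ∈ (M n).thick (Q n) ε := by
  obtain ⟨v, rfl⟩ := N.proj_surjective p
  obtain ⟨s, hs, hinj⟩ := N.injOn_of_lt_injRad hp.2
  filter_upwards [hR.eventually_ge_atTop (dist (N.proj v) x + ε / 2 + 2),
    hη0.eventually_lt_const (sub_pos.2 hs), hη0.eventually_le_const one_pos] with n hR hηs hη1
  exact (H n).map_mem_thick (hη n) hε le_rfl (by simpa using hinj) (by linarith) (by linarith)

/-- Thickness of the approximating points passes to their limit. -/
theorem mem_thick_of_tendsto (H : ∀ n, IsApproximation (M n) (Q n) (x' n) N x (R n) (η n) (g n)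
      (u n) (h n)) (hη0 : Tendsto η atTop (𝓝 0)) (hR : Tendsto R atTop atTop)
    {l : Filter ℕ} [l.NeBot] (hl : l ≤ atTop) {δ : ℝ} (hδ : 0 < δ) {q : ℕ → N} {p : N}
    (hq : Tendsto q l (𝓝 p)) (hthick : ∀ᶠ n in l, g n (q n) ∈ (M n).thick (Q n) δ) :
    p ∈ N.thick univ δ := by
  obtain ⟨w, rfl⟩ := N.proj_surjective p
  refine ⟨trivial, N.ofReal_le_injRad (half_pos hδ).le ?_⟩
  rintro a ⟨ha, -⟩ b ⟨hb, -⟩ hab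
  obtain ⟨s, hs, hsδ⟩ := exists_between (max_lt (Metric.mem_ball.1 ha) (Metric.mem_ball.1 hb))
  have ht : 0 < (δ / 2 - s) / 2 := by linarith
  have hclose : ∀ᶠ n in l, dist a b ≤ η n := by
    filter_upwards [hthick, (Metric.tendsto_nhds.1 hq) _ ht, hl (hη0.eventually_le_const ht),
      hl (hR.eventually_ge_atTop (dist (N.proj w) x + s + (δ / 2 - s) / 2))] with n hn hqn hηn hRn
    rw [dist_comm] at hqn
    exact (H n).dist_le_of_map_mem_thick hδ hn le_rfl hqn.le (max_lt_iff.1 hs).1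
      (max_lt_iff.1 hs).2 (by linarith) hRn hab
  exact dist_le_zero.1 (ge_of_tendsto (hη0.mono_left hl) hclose)

end Sequence

theorem theorem5p1 (δ ε J : ℝ) (hδ : 0 < δ) (hε : 0 < ε) (hJ : 1 < J)
    (Y Z : HypManifold) (y : Y) (z : Z)
    (Ym Zm : ℕ → HypManifold) (ym : ∀ m, Ym m) (zm : ∀ m, Zm m)
    (hY : ConvergesGeometrically Ym (fun _ => Set.univ) ym Y y)
    (hZ : ConvergesGeometrically Zm (fun _ => Set.univ) zm Z z)
    (Yc : ∀ m, Set (Ym m)) (Zc : ∀ m, Set (Zm m))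
    (hYc : ∀ m, (Ym m).IsConvex (Yc m)) (hZc : ∀ m, (Zm m).IsConvex (Zc m))
    (hy : y ∈ Y.strictThick Set.univ ε)
    (hym : ∀ m, ym m ∈ (Ym m).thick (Yc m) ε)
    (hzm : ∀ m, zm m ∈ Zc m)
    (hYconv : ConvergesGeometrically Ym Yc ym Y y)
    (hZconv : ConvergesGeometrically Zm Zc zm Z z)
    -- `Y^{≥ ε}` is the closure of `Y^{> ε}`
    (hcl : closure (Y.strictThick Set.univ ε) = Y.thick Set.univ ε)
    (φ : ∀ m, (Ym m).thick (Yc m) ε → (Zm m).thick (Zc m) δ)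
    (hφ : ∀ m, IsBilipschitzInclusion J (φ m))
    (hbdd : ∃ D : ℝ, ∀ m, dist (φ m ⟨ym m, hym m⟩ : Zm m) (zm m) ≤ D) :
    ∃ ψ : Y.thick Set.univ ε → Z.thick Set.univ δ, IsBilipschitzInclusion J ψ := by
  have hJ0 : 0 ≤ J := by linarith
  rw [← hcl]
  suffices ∃ ψ : Y.strictThick univ ε → Z.thick univ δ, IsBilipschitzInclusion J ψ by
    obtain ⟨ψ, hψ⟩ := this
    exact exists_isBilipschitzInclusion_closure (Z.isClosed_thick_univ hδ) hJ0 ψ hψ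
  obtain ⟨D, hD⟩ := hbdd
  let R : ℕ → ℝ := fun n => n + 1
  let η : ℕ → ℝ := fun n => 1 / ((n : ℝ) + 1)
  have hη : ∀ n, 0 < η n := fun n => Nat.one_div_pos_of_nat
  have hη0 : Tendsto η atTop (𝓝 0) := tendsto_one_div_add_atTop_nhds_zero_nat
  have hR : Tendsto R atTop atTop :=
    tendsto_atTop_add_const_right _ _ tendsto_natCast_atTop_atTop
  have hηR : ∀ n, η n ≤ R n := fun n => by
    have h1 : (1 : ℝ) ≤ n + 1 := by linarith [n.cast_nonneg (α := ℝ)]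
    exact (div_le_one_of_le₀ h1 (by positivity)).trans h1
  have hR0 : ∀ n, 0 < R n := fun n => (hη n).trans_le (hηR n)
  -- The charts of different scales are unrelated to each other, so a single index `m n`, with its
  -- two charts, is fixed for each scale `n`.
  have hex := fun n => ((hYconv.eventually_isApproximation (hR0 n) (hη n) (hηR n)).and
    (hZconv.eventually_isApproximation (hR0 n) (hη n) (hηR n))).exists
  choose m hmY hmZ using hex
  choose g u h HY using hmY
  choose g' u' h' HZ using hmZ
  obtain ⟨U, hU⟩ := Ultrafilter.exists_le (atTop : Filter ℕ)
  have hpull : ∀ p : Y.strictThick univ ε, ∃ (C : ℝ) (q : ℕ → Z), ∀ᶠ n in atTop,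
      dist (q n) z ≤ C ∧ ∃ hp : g n p ∈ (Ym (m n)).thick (Yc (m n)) ε,
        g' n (q n) = φ (m n) ⟨g n p, hp⟩ := by
    intro p
    have hC : ∀ᶠ n in atTop, ∃ q, dist q z ≤ J * (dist (p : Y) y + 1) + D + 1 ∧
        ∃ hp : g n p ∈ (Ym (m n)).thick (Yc (m n)) ε, g' n q = φ (m n) ⟨g n p, hp⟩ := by
      filter_upwards [eventually_map_mem_thick HY hη hη0 hR hε p.2,
        hη0.eventually_le_const one_pos,
        hR.eventually_ge_atTop (3 * dist (p : Y) y + 3),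
        hR.eventually_ge_atTop (J * (dist (p : Y) y + 1) + D + 1)] with n hp hη1 hR1 hR2
      have h1 := (abs_le.1 ((HY n).abs_dist_map_sub_le (hη n) (r := dist (p : Y) y) (by linarith)
        le_rfl (by simp : dist y y ≤ dist (p : Y) y))).2
      rw [(HY n).map_base] at h1
      have h2 : dist (φ (m n) ⟨g n p, hp⟩ : Zm (m n)) (φ (m n) ⟨ym (m n), hym _⟩) ≤
          J * (dist (p : Y) y + 1) :=
        ((hφ (m n)) _ _).2.trans (mul_le_mul_of_nonneg_left
          (show dist (g n p) (ym (m n)) ≤ _ by linarith) hJ0)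
      have h3 : dist (φ (m n) ⟨g n p, hp⟩ : Zm (m n)) (zm (m n)) ≤
          J * (dist (p : Y) y + 1) + D :=
        (dist_triangle _ _ _).trans (add_le_add h2 (hD _))
      obtain ⟨q, hq, hgq⟩ := (HZ n).exists_map_eq (hη n) h3 (by linarith)
      exact ⟨q, by linarith, hp, hgq⟩
    obtain ⟨q, hq⟩ := hC.choice
    exact ⟨_, q, hq⟩
  choose C q hq using hpull
  choose ψ hψ using fun p => U.exists_tendsto_of_dist_le (hU ((hq p).mono fun n hn => hn.1))
  refine ⟨fun p => ⟨ψ p, mem_thick_of_tendsto HZ hη0 hR hU hδ (hψ p)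
    (hU ((hq p).mono fun n hn => ?_))⟩, fun p p' => ?_⟩
  · obtain ⟨-, hp, heq⟩ := hn
    rw [heq]
    exact (φ (m n) _).2
  · have hbound : ∀ p p', ∀ᶠ n in U, dist (q p n) z ≤ max (C p) (C p') := fun p p' =>
      hU ((hq p).mono fun n hn => hn.1.trans (le_max_left _ _))
    have hsource : Tendsto (fun n => dist (g n p) (g n p')) U (𝓝 (dist (p : Y) p')) := by
      have := (tendsto_dist_map_sub HY hη hη0 hR hU (a := fun _ => (p : Y)) (b := fun _ => (p' : Y))
        (Eventually.of_forall fun _ => le_max_left (dist (p : Y) y) (dist (p' : Y) y))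
        (Eventually.of_forall fun _ => le_max_right _ _)).add_const (dist (p : Y) p')
      simpa using this
    have htarget : Tendsto (fun n => dist (g' n (q p n)) (g' n (q p' n))) U
        (𝓝 (dist (ψ p) (ψ p'))) := by
      have := (tendsto_dist_map_sub HZ hη hη0 hR hU (hbound p p')
        (max_comm (C p) (C p') ▸ hbound p' p)).add ((hψ p).dist (hψ p'))
      simpa using this
    refine ⟨le_of_tendsto_of_tendsto (hsource.const_mul _) htarget (hU ?_),
      le_of_tendsto_of_tendsto htarget (hsource.const_mul _) (hU ?_)⟩ <;>
    filter_upwards [hq p, hq p'] with n ⟨_, hp, h1⟩ ⟨_, hp', h2⟩ <;> rw [h1, h2]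
    · exact (hφ (m n) ⟨_, hp⟩ ⟨_, hp'⟩).1
    · exact (hφ (m n) ⟨_, hp⟩ ⟨_, hp'⟩).2
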